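/- Let $R$ be a commutative artinian ring. For a small preadditive category $\mathcal{A}$, let $\mathrm{Mod}(\mathcal{A})$ be the category of additive functors $\mathcal{A}\to\mathbf{Ab}$, and $\mathrm{mod}(\mathcal{A})$ its full subcategory of finitely presented modules $M$, i.e. those admitting an exact sequence $\mathrm{Hom}_{\mathcal{A}}(X,-)\to \mathrm{Hom}_{\mathcal{A}}(Y,-)\to M\to 0$. A dualizing $R$-variety is a small additive $R$-linear category $\mathcal{C}$ with split idempotents, all of whose $\mathrm{Hom}$-modules are finitely generated over $R$, such that $M\mapsto \mathrm{Hom}_R(M(-),E)$, with $E$ the injective envelope of $R/\mathrm{rad}(R)$, induces a duality between $\mathrm{mod}(\mathcal{C})$ and $\mathrm{mod}(\mathcal{C}^{op})$. (Here $M(X)$ is an $R$-module through $R\to\mathrm{End}_{\mathcal{C}}(X)$.) Let $\mathcal{C}$ be a dualizing $R$-variety, let $C\in\mathcal{C}$ and $P=\mathrm{Hom}_{\mathcal{C}}(C,-)$. Let $\mathcal{I}=\mathrm{Tr}_P\mathcal{C}$ be the trace ideal of $\mathcal{C}$, that is, $$\mathcal{I}(X,Y)=\sum_{f\in\mathrm{Hom}(P,\mathrm{Hom}_{\mathcal{C}}(X,-))}\mathrm{Im}(f_Y)\subseteq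 \mathrm{Hom}_{\mathcal{C}}(X,Y).$$ Let $\pi:\mathcal{C}\to\mathcal{C}/\mathcal{I}$ be the quotient functor and $\pi_*:\mathrm{Mod}(\mathcal{C}/\mathcal{I})\to\mathrm{Mod}(\mathcal{C})$, $F\mapsto F\circ\pi$. For $0\le m\le\infty$ the ideal $\mathcal{I}$ is called $m$-idempotent if the maps $$\mathrm{Ext}^i_{\mathrm{Mod}(\mathcal{C}/\mathcal{I})}(F,F')\to\mathrm{Ext}^i_{\mathrm{Mod}(\mathcal{C})}(\pi_*F,\pi_*F')$$ induced by the exact functor $\pi_*$ are isomorphisms for all $F,F'\in\mathrm{Mod}(\mathcal{C}/\mathcal{I})$ and all integers $0\le i\le m$ (for all $i\ge 0$ if $m=\infty$). Let $\mathrm{add}(P)$ be the class of direct summands of finite direct sums of copies of $P$, and for $0\le k\le\infty$ let $\mathbb{P}_k$ be the class of modules $X\in\mathrm{mod}(\mathcal{C})$ having a projective resolution $\cdots\to P_1\to P_0\to X\to 0$ in $\mathrm{mod}(\mathcal{C})$ with $P_i\in\mathrm{add}(P)$ for all integers $0\le i\le k$ (for all $i\geq 0$ if $k=\infty$). Then for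 every $1\le k\le\infty$ (with $\infty+1=\infty$), the ideal $\mathcal{I}$ is $(k+1)$-idempotent if and only if $\mathcal{I}(C',-)\in\mathbb{P}_k$ for every $C'\in\mathcal{C}$. -/

import Mathlib

open CategoryTheory CategoryTheory.Limits Opposite

universe u

namespace KIdempotent

noncomputable section

/-! ### Modules over a small preadditive category -/

/-- `Mod(C)`: the category of additive functors from the small preadditive category `C` to
abelian groups. -/
abbrev CMod (C : Type u) [SmallCategory C] [Preadditive C] : Type (u + 1) :=
  C ⥤+ AddCommGrpCat.{u}

section Abelian

variable {C : Type u} [SmallCategory C] [Preadditive C]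

/-- A pointwise limit of additive functors is additive. -/
lemma additive_of_isLimit {J : Type*} [Category* J] {D : J ⥤ (C ⥤ AddCommGrpCat.{u})}
    {c : Cone D} (hc : IsLimit c) [HasLimitsOfShape J AddCommGrpCat.{u}]
    (hD : ∀ j, (D.obj j).Additive) : c.pt.Additive where
  map_add {X Y f g} := by
    refine (isLimitOfPreserves ((evaluation C AddCommGrpCat.{u}).obj Y) hc).hom_ext fun j => ?_
    have h1 (h : X ⟶ Y) := (c.π.app j).naturality h
    have h2 := (hD j).map_add (f := f) (g := g)
    dsimp at h1 ⊢
    rw [Preadditive.add_comp, h1, h1, h1, h2, Preadditive.comp_add]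

/-- A pointwise colimit of additive functors is additive. -/
lemma additive_of_isColimit {J : Type*} [Category* J] {D : J ⥤ (C ⥤ AddCommGrpCat.{u})}
    {c : Cocone D} (hc : IsColimit c) [HasColimitsOfShape J AddCommGrpCat.{u}]
    (hD : ∀ j, (D.obj j).Additive) : c.pt.Additive where
  map_add {X Y f g} := by
    refine (isColimitOfPreserves ((evaluation C AddCommGrpCat.{u}).obj X) hc).hom_ext fun j => ?_
    have h1 (h : X ⟶ Y) := (c.ι.app j).naturality h
    have h2 := (hD j).map_add (f := f) (g := g)
    dsimp at h1 ⊢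
    rw [Preadditive.comp_add, ← h1, ← h1, ← h1, h2, Preadditive.add_comp]

instance closedLimits (J : Type) [SmallCategory J] :
    (additiveFunctor C AddCommGrpCat.{u}).IsClosedUnderLimitsOfShape J where
  limitsOfShape_le := by
    rintro _ ⟨p⟩
    exact additive_of_isLimit p.isLimit p.prop_diag_obj

instance closedColimits (J : Type) [SmallCategory J] :
    (additiveFunctor C AddCommGrpCat.{u}).IsClosedUnderColimitsOfShape J where
  colimitsOfShape_le := by
    rintro _ ⟨p⟩
    exact additive_of_isColimit p.isColimit p.prop_diag_obj

instance : (additiveFunctor C AddCommGrpCat.{u}).IsClosedUnderKernels where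
  kernels_le := by
    rintro _ ⟨f, k, hk, hf⟩
    exact additive_of_isLimit hk (by rintro (_ | _); exacts [hf.1, hf.2])

instance : (additiveFunctor C AddCommGrpCat.{u}).IsClosedUnderCokernels where
  cokernels_le := by
    rintro _ ⟨f, k, hk, hf⟩
    exact additive_of_isColimit hk (by rintro (_ | _); exacts [hf.1, hf.2])

instance : (additiveFunctor C AddCommGrpCat.{u}).IsClosedUnderFiniteProducts :=
  .of_isClosedUnderLimitsOfShape fun _ => inferInstance

instance : (additiveFunctor C AddCommGrpCat.{u}).ContainsZero where
  exists_zero := ⟨(Functor.const C).obj (AddCommGrpCat.of PUnit.{u + 1}),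
    (Functor.isZero_iff _).2 fun _ =>
      AddCommGrpCat.isZero_of_subsingleton (AddCommGrpCat.of PUnit.{u + 1}),
    ⟨fun {_ _ _ _} =>
      (AddCommGrpCat.isZero_of_subsingleton (AddCommGrpCat.of PUnit.{u + 1})).eq_of_src _ _⟩⟩

instance modAbelian : Abelian (CMod C) := inferInstance

instance : PreservesFiniteLimits (AdditiveFunctor.forget C AddCommGrpCat.{u}) where
  preservesFiniteLimits _ _ _ := inferInstance

instance : PreservesFiniteColimits (AdditiveFunctor.forget C AddCommGrpCat.{u}) where
  preservesFiniteColimits _ _ _ := inferInstance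

instance modHasFiniteBiproducts : HasFiniteBiproducts (CMod C) := Abelian.hasFiniteBiproducts

instance modHasExt : HasExt.{u + 1} (CMod C) := HasExt.standard _

end Abelian

section Modules

variable {C : Type u} [SmallCategory C] [Preadditive C]

/-- The representable module `Hom_C(X, -)`. -/
def rep (X : C) : CMod C := AdditiveFunctor.of (preadditiveCoyoneda.obj (op X))

/-- `M` is finitely presented: there is an exact sequence
`Hom_C(X, -) ⟶ Hom_C(Y, -) ⟶ M ⟶ 0`. -/
def finPres (C : Type u) [SmallCategory C] [Preadditive C] : ObjectProperty (CMod C) := fun M =>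
  ∃ (X Y : C) (f : rep X ⟶ rep Y) (g : rep Y ⟶ M) (w : f ≫ g = 0),
    (ShortComplex.mk f g w).Exact ∧ Epi g

/-- `mod(C)`: the full subcategory of finitely presented modules. -/
abbrev FPMod (C : Type u) [SmallCategory C] [Preadditive C] : Type (u + 1) :=
  (finPres C).FullSubcategory

/-- `X ∈ add(P)`: `X` is a direct summand of a finite direct sum of copies of `P`. -/
def InAdd (P X : CMod C) : Prop :=
  ∃ (Y : CMod C) (n : ℕ), Nonempty ((X ⊞ Y) ≅ ⨁ fun _ : Fin n => P)

/-- `X ∈ ℙ_k`: `X` lies in `mod(C)` and has a projective resolution in `mod(C)` whose terms in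
degrees `0, …, k` belong to `add(P)` (all terms, if `k = ∞`). -/
def InPk (P : CMod C) (k : ℕ∞) (X : CMod C) : Prop :=
  finPres C X ∧ ∃ Q : ProjectiveResolution X,
    (∀ i : ℕ, finPres C (Q.complex.X i)) ∧ ∀ i : ℕ, (i : ℕ∞) ≤ k → InAdd P (Q.complex.X i)

/-- The trace of `P` in `F`, evaluated at `X`: the sum of the images of all morphisms
`P ⟶ F`. -/
def trace (P F : CMod C) (X : C) : AddSubgroup (F.obj.obj X) :=
  ⨆ f : P ⟶ F, (f.hom.app X).hom.range

lemma trace_map (P : CMod C) {F G : CMod C} (φ : F ⟶ G) (X : C) {x : F.obj.obj X}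
    (hx : x ∈ trace P F X) : (φ.hom.app X).hom x ∈ trace P G X := by
  have : trace P F X ≤ (trace P G X).comap (φ.hom.app X).hom := by
    refine iSup_le fun f => ?_
    rintro _ ⟨y, rfl⟩
    exact AddSubgroup.mem_iSup_of_mem (f ≫ φ) ⟨y, rfl⟩
  exact this hx

lemma trace_functorial (P F : CMod C) {X Y : C} (h : X ⟶ Y) {x : F.obj.obj X}
    (hx : x ∈ trace P F X) : (F.obj.map h).hom x ∈ trace P F Y := by
  have : trace P F X ≤ (trace P F Y).comap (F.obj.map h).hom := by
    refine iSup_le fun f => ?_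
    rintro _ ⟨y, rfl⟩
    refine AddSubgroup.mem_iSup_of_mem f ⟨(P.obj.map h).hom y, ?_⟩
    exact congrArg (fun k => k.hom y) (f.hom.naturality h)
  exact this hx

end Modules

/-! ### Ideals of a preadditive category and quotient categories -/

/-- A two-sided ideal of a preadditive category. -/
structure CatIdeal (C : Type u) [SmallCategory C] [Preadditive C] where
  /-- the subgroup `I(X, Y)` of `Hom_C(X, Y)` -/
  hom (X Y : C) : AddSubgroup (X ⟶ Y)
  comp_left {X Y Z : C} (g : X ⟶ Y) {f : Y ⟶ Z} : f ∈ hom Y Z → g ≫ f ∈ hom X Z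
  comp_right {X Y Z : C} {f : X ⟶ Y} (h : Y ⟶ Z) : f ∈ hom X Y → f ≫ h ∈ hom X Z

namespace CatIdeal

variable {C : Type u} [SmallCategory C] [Preadditive C]

/-- The trace ideal `Tr_P C`, with `(Tr_P C)(X, Y) = Tr_P(Hom_C(X, -))(Y)`. -/
def ofTrace (P : CMod C) : CatIdeal C where
  hom X Y := trace P (rep X) Y
  comp_left {X Y Z} g _ hf :=
    trace_map P (F := rep Y) (G := rep X)
      (ObjectProperty.homMk (preadditiveCoyoneda.map g.op)) Z hf
  comp_right {X _ _} _ h hf := trace_functorial P (rep X) h hf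

variable (I : CatIdeal C)

/-- The module `I(X, -)`, a submodule of `Hom_C(X, -)`. -/
def module (X : C) : CMod C :=
  ⟨{ obj := fun Y => AddCommGrpCat.of (I.hom X Y)
     map := fun {Y Z} h => AddCommGrpCat.ofHom
      { toFun := fun f => ⟨f.1 ≫ h, I.comp_right h f.2⟩
        map_zero' := by ext; simp
        map_add' := fun _ _ => by ext; simp }
     map_id := fun _ => by ext; simp
     map_comp := fun _ _ => by ext; simp },
   ⟨fun {_ _ _ _} => by
      ext x
      exact Preadditive.comp_add _ _ _ x.1 _ _⟩⟩

/-- Congruence modulo `I`. -/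
def rel : HomRel C := fun X Y f g => f - g ∈ I.hom X Y

instance : Congruence I.rel where
  equivalence :=
    { refl := fun f => by simp [rel, zero_mem]
      symm := fun {f g} h => by simpa [rel] using neg_mem h
      trans := fun {f g h} h₁ h₂ => by simpa [rel] using add_mem h₁ h₂ }
  comp_left f _ _ h := by
    simpa [rel, Preadditive.comp_sub] using I.comp_left f h
  comp_right g h := by
    simpa [rel, Preadditive.sub_comp] using I.comp_right g h

lemma rel_add ⦃X Y : C⦄ (f₁ f₂ g₁ g₂ : X ⟶ Y) (hf : I.rel f₁ f₂) (hg : I.rel g₁ g₂) :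
    I.rel (f₁ + g₁) (f₂ + g₂) := by
  have := add_mem hf hg
  rwa [← add_sub_add_comm] at this

/-- The quotient category `C/I`. -/
abbrev Quot : Type u := Quotient I.rel

instance : Preadditive I.Quot := Quotient.preadditive I.rel I.rel_add

/-- The canonical functor `π : C ⥤ C/I`. -/
abbrev proj : C ⥤ I.Quot := Quotient.functor I.rel

instance : I.proj.Additive := Quotient.functor_additive I.rel I.rel_add

/-- The functor `π_* : Mod(C/I) ⥤ Mod(C)`, `F ↦ F ∘ π`. -/
def pushforward : CMod I.Quot ⥤ CMod C :=
  (additiveFunctor C AddCommGrpCat.{u}).lift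
    (AdditiveFunctor.forget I.Quot AddCommGrpCat.{u} ⋙
      (Functor.whiskeringLeft C I.Quot AddCommGrpCat.{u}).obj I.proj)
    (fun F => (inferInstance : (I.proj ⋙ F.obj).Additive))

instance : I.pushforward.Additive where
  map_add := rfl

instance : PreservesFiniteLimits I.pushforward where
  preservesFiniteLimits J _ _ :=
    have : PreservesLimitsOfShape J
        (I.pushforward ⋙ AdditiveFunctor.forget C AddCommGrpCat.{u}) :=
      inferInstanceAs (PreservesLimitsOfShape J
        (AdditiveFunctor.forget I.Quot AddCommGrpCat.{u} ⋙
          (Functor.whiskeringLeft C I.Quot AddCommGrpCat.{u}).obj I.proj))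
    preservesLimitsOfShape_of_reflects_of_preserves _
      (AdditiveFunctor.forget C AddCommGrpCat.{u})

instance : PreservesFiniteColimits I.pushforward where
  preservesFiniteColimits J _ _ :=
    have : PreservesColimitsOfShape J
        (I.pushforward ⋙ AdditiveFunctor.forget C AddCommGrpCat.{u}) :=
      inferInstanceAs (PreservesColimitsOfShape J
        (AdditiveFunctor.forget I.Quot AddCommGrpCat.{u} ⋙
          (Functor.whiskeringLeft C I.Quot AddCommGrpCat.{u}).obj I.proj))
    preservesColimitsOfShape_of_reflects_of_preserves _
      (AdditiveFunctor.forget C AddCommGrpCat.{u})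

/-- `I` is `k`-idempotent: the maps
`Ext^i_{Mod(C/I)}(F, F') ⟶ Ext^i_{Mod(C)}(π_* F, π_* F')` induced by the exact functor `π_*`
are isomorphisms for all `F, F'` and all natural numbers `i ≤ k`. For `k = ∞` this says that `I`
is strongly idempotent. -/
def IsKIdempotent (k : ℕ∞) : Prop :=
  ∀ i : ℕ, (i : ℕ∞) ≤ k → ∀ F F' : CMod I.Quot,
    Function.Bijective (I.pushforward.mapExtAddHom F F' i)

end CatIdeal

/-! ### Dualizing varieties -/

section Dualizing

variable (R : Type u) [CommRing R]

/-- `ι : A → E` is an injective envelope of the `R`-module `A`: `E` is an injective module and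
`ι` is an essential monomorphism. -/
structure IsInjectiveEnvelope {A E : Type u} [AddCommGroup A] [Module R A] [AddCommGroup E]
    [Module R E] (ι : A →ₗ[R] E) : Prop where
  injective_module : Module.Injective R E
  injective : Function.Injective ι
  essential : ∀ N : Submodule R E, N ⊓ LinearMap.range ι = ⊥ → N = ⊥

variable {C : Type u} [SmallCategory C] [Preadditive C] [Linear R C]

/-- The `R`-module structure on `M(X)`, coming from the ring homomorphism `R → End_C(X)`. -/
@[reducible]
def moduleObj (M : CMod C) (X : C) : Module R (M.obj.obj X) where
  smul r x := (M.obj.map (r • 𝟙 X)).hom x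
  one_smul x := by
    change (M.obj.map ((1 : R) • 𝟙 X)).hom x = x
    simp
  mul_smul r s x := by
    change (M.obj.map ((r * s) • 𝟙 X)).hom x =
      (M.obj.map (r • 𝟙 X)).hom ((M.obj.map (s • 𝟙 X)).hom x)
    rw [← AddCommGrpCat.comp_apply, ← M.obj.map_comp]
    simp [smul_smul]
  smul_zero r := map_zero _
  smul_add r x y := map_add _ _ _
  add_smul r s x := by
    change (M.obj.map ((r + s) • 𝟙 X)).hom x =
      (M.obj.map (r • 𝟙 X)).hom x + (M.obj.map (s • 𝟙 X)).hom x
    rw [add_smul, M.obj.map_add]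
    rfl
  zero_smul x := by
    change (M.obj.map ((0 : R) • 𝟙 X)).hom x = 0
    rw [zero_smul, M.obj.map_zero]
    rfl

/-- `M(X)` as an `R`-module. -/
def linObj (M : CMod C) (X : C) : ModuleCat.{u} R :=
  letI := moduleObj R M X
  ModuleCat.of R (M.obj.obj X)

/-- An additive map that commutes with the action of `R`, as an `R`-linear map. -/
def linHom {M N : CMod C} {X Y : C} (g : M.obj.obj X ⟶ N.obj.obj Y)
    (hg : ∀ r : R, M.obj.map (r • 𝟙 X) ≫ g = g ≫ N.obj.map (r • 𝟙 Y)) :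
    linObj R M X ⟶ linObj R N Y :=
  letI := moduleObj R M X
  letI := moduleObj R N Y
  ModuleCat.ofHom (X := M.obj.obj X) (Y := N.obj.obj Y)
    { toFun := fun x => g.hom x
      map_add' := fun x y => map_add _ x y
      map_smul' := fun r x => congrArg (fun k => k.hom x) (hg r) }

/-- The identification of `Mod(C)` with functors to `R`-modules. -/
def toLinear : CMod C ⥤ (C ⥤ ModuleCat.{u} R) where
  obj M :=
    { obj := fun X => linObj R M X
      map := fun f => linHom R (M.obj.map f) fun r => by
        rw [← M.obj.map_comp, ← M.obj.map_comp]
        simp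
      map_id := fun X => ConcreteCategory.hom_ext _ _ fun x =>
        congrArg (fun k => k.hom x) (M.obj.map_id X)
      map_comp := fun f g => ConcreteCategory.hom_ext _ _ fun x =>
        congrArg (fun k => k.hom x) (M.obj.map_comp f g) }
  map {M N} φ :=
    { app := fun X => linHom R (φ.hom.app X) fun r => φ.hom.naturality (r • 𝟙 X)
      naturality := fun _ _ f => ConcreteCategory.hom_ext _ _ fun x =>
        congrArg (fun k => k.hom x) (φ.hom.naturality f) }

instance (M : CMod C) : ((toLinear R).obj M).Additive where
  map_add {X Y f g} := ConcreteCategory.hom_ext _ _ fun x =>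
    congrArg (fun k => k.hom x) (M.obj.map_add (f := f) (g := g))

/-- The contravariant functor `𝔻_C : Mod(C) → Mod(Cᵒᵖ)`, `𝔻_C(M)(X) = Hom_R(M(X), E)`. -/
def dual (E : ModuleCat.{u} R) : (CMod C)ᵒᵖ ⥤ CMod Cᵒᵖ :=
  (additiveFunctor Cᵒᵖ AddCommGrpCat.{u}).lift
    ((toLinear R).op ⋙ Functor.opHom C (ModuleCat.{u} R) ⋙
      (Functor.whiskeringRight Cᵒᵖ (ModuleCat.{u} R)ᵒᵖ AddCommGrpCat.{u}).obj
        (preadditiveYoneda.obj E))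
    (fun M => (inferInstance :
      (((toLinear R).obj M.unop).op ⋙ preadditiveYoneda.obj E).Additive))

/-- The functor `mod(C)ᵒᵖ ⥤ mod(Cᵒᵖ)` induced by `𝔻_C`, when `𝔻_C` preserves finitely
presented modules. -/
def dualFP (E : ModuleCat.{u} R)
    (h : ∀ M : CMod C, finPres C M → finPres Cᵒᵖ ((dual R E).obj (op M))) :
    (FPMod C)ᵒᵖ ⥤ FPMod Cᵒᵖ :=
  (finPres Cᵒᵖ).lift ((finPres C).ι.op ⋙ dual R E) (fun M => h _ M.unop.property)

variable (C)

/-- A dualizing `R`-variety: a small additive `R`-linear category with split idempotents and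
finitely generated `Hom`-modules such that `𝔻_C`, formed with the injective envelope `E` of
`R/rad(R)`, induces a duality between `mod(C)` and `mod(Cᵒᵖ)`. -/
structure IsDualizingVariety : Prop where
  hasFiniteBiproducts : HasFiniteBiproducts C
  isIdempotentComplete : IsIdempotentComplete C
  hom_finite : ∀ X Y : C, Module.Finite R (X ⟶ Y)
  duality : ∃ (E : ModuleCat.{u} R) (ι : (R ⧸ Ring.jacobson R) →ₗ[R] E),
    IsInjectiveEnvelope R ι ∧
      ∃ h : ∀ M : CMod C, finPres C M → finPres Cᵒᵖ ((dual R E).obj (op M)),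
        (dualFP R E h).IsEquivalence

end Dualizing

end

end KIdempotent

/-! Let `I` be the trace ideal of `P = rep A`. The short exact sequence `0 ⟶ I(X, -) ⟶ Hom_C(X, -) ⟶
π_* Hom_{C/I}(X, -) ⟶ 0` shifts degrees: for any ideal, being `(k + 1)`-idempotent amounts to
`Ext^n(I(X, -), π_* F) = 0` for `n ≤ k` (`isKIdempotent_add_one_iff`). One direction uses that
representables over `C/I` are projective; the other covers a module by a coproduct of them and
compares long exact sequences, `π_*` being fully faithful and exact (`mapExt_bijective_of_le`).

For the trace ideal the modules `π_* F` are, up to isomorphism, those vanishing at `A`. If `M` has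
no nonzero map to such modules, then `M` is generated by `M(A)`; when `M(A)` is finite over `R`,
this gives an epimorphism `Hom_C(Aⁿ, -) ⟶ M`. The vanishing of `Ext` passes to its kernel, one
degree lower, and the kernel of a map in `mod(C)` is finitely presented by duality; iteration yields
the resolution (`inPk_of_finPres`). Conversely, `add(P)` has no nonzero maps to modules vanishing at
`A`, so a resolution in `add(P)` kills `Ext` (`InPk.ext_subsingleton`).

It remains to see that `I(X, -)` is finitely presented. As `R` is noetherian, `I(X, A)` is finite
over `R`; vanishing of `Hom` and `Ext¹` makes both `I(X, -)` and the kernel of a cover finitely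
generated (`finPres_module_ofTrace`). This is where `k ≥ 1` enters. -/

namespace KIdempotent

noncomputable section

/-! ### Resolutions and dimension shifting in abelian categories -/

section AbelianCategories

open Abelian

universe w w' v v' u₁ u₂

lemma projective_sigma {𝒜 : Type u₁} [Category.{v} 𝒜] {J : Type w'} (Q : J → 𝒜)
    [HasCoproduct Q] (hQ : ∀ j, Projective (Q j)) : Projective (∐ Q) where
  factors f e _ := ⟨Sigma.desc fun j => Projective.factorThru (Sigma.ι Q j ≫ f) e, by ext j; simp⟩

variable {𝒜 : Type u₁} [Category.{v} 𝒜] [Abelian 𝒜]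

/-- The projective resolution spliced together from short exact sequences
`0 ⟶ K (n + 1) ⟶ Q n ⟶ K n ⟶ 0` with projective middle terms. -/
def resolutionOfSyzygies (K Q : ℕ → 𝒜) (hQ : ∀ n, Projective (Q n))
    (p : ∀ n, Q n ⟶ K n) (hp : ∀ n, Epi (p n)) (i : ∀ n, K (n + 1) ⟶ Q n) (hi : ∀ n, Mono (i n))
    (w : ∀ n, i n ≫ p n = 0) (hex : ∀ n, (ShortComplex.mk (i n) (p n) (w n)).Exact) :
    ProjectiveResolution (K 0) :=
  have w' (n : ℕ) : (p (n + 1) ≫ i n) ≫ p n = 0 := by rw [Category.assoc, w, comp_zero]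
  have hex' (n : ℕ) : (ShortComplex.mk (p (n + 1) ≫ i n) (p n) (w' n)).Exact := by
    -- Precomposing the first map with an epimorphism does not affect exactness; below, dually,
    -- neither does postcomposing the second map with the monomorphism `i n`.
    let φ : ShortComplex.mk (p (n + 1) ≫ i n) (p n) (w' n) ⟶ ShortComplex.mk (i n) (p n) (w n) :=
      { τ₁ := p (n + 1), τ₂ := 𝟙 _, τ₃ := 𝟙 _ }
    have : Epi φ.τ₁ := hp (n + 1)
    exact (ShortComplex.exact_iff_of_epi_of_isIso_of_mono φ).2 (hex n)
  have hd (n : ℕ) : (p (n + 1 + 1) ≫ i (n + 1)) ≫ p (n + 1) ≫ i n = 0 := by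
    rw [← Category.assoc, w' (n + 1), zero_comp]
  have hex'' (n : ℕ) : (ShortComplex.mk _ _ (hd n)).Exact := by
    let φ : ShortComplex.mk _ _ (w' (n + 1)) ⟶ ShortComplex.mk _ _ (hd n) :=
      { τ₁ := 𝟙 _, τ₂ := 𝟙 _, τ₃ := i n }
    have : Mono φ.τ₃ := hi n
    exact (ShortComplex.exact_iff_of_epi_of_isIso_of_mono φ).1 (hex' (n + 1))
  have d_eq (n : ℕ) : (ChainComplex.of Q (fun n => p (n + 1) ≫ i n) hd).d (n + 1) n =
      p (n + 1) ≫ i n := ChainComplex.of_d Q (fun n => p (n + 1) ≫ i n) n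
  have hπ₀ : (ChainComplex.of Q (fun n => p (n + 1) ≫ i n) hd).d 1 0 ≫ p 0 = 0 := by
    rw [d_eq 0]
    exact w' 0
  let π := (ChainComplex.toSingle₀Equiv _ _).symm ⟨p 0, hπ₀⟩
  have hπ : π.f 0 = p 0 := ChainComplex.toSingle₀Equiv_symm_apply_f_zero _ _
  { complex := ChainComplex.of Q (fun n => p (n + 1) ≫ i n) hd
    projective := hQ
    π := π
    quasiIso := ⟨fun n => by
      cases n with
      | zero =>
        rw [ChainComplex.quasiIsoAt₀_iff, ShortComplex.quasiIso_iff_of_zeros']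
        · refine (ShortComplex.exact_and_epi_g_iff_of_iso ?_).2 ⟨hex' 0, hp 0⟩
          exact ShortComplex.isoMk (Iso.refl _) (Iso.refl _) (Iso.refl _)
            ((Category.id_comp _).trans ((d_eq 0).symm.trans (Category.comp_id _).symm))
            ((Category.id_comp _).trans (hπ.symm.trans (Category.comp_id (π.f 0)).symm))
        all_goals rfl
      | succ n =>
        rw [quasiIsoAt_iff_exactAt']
        · rw [HomologicalComplex.exactAt_iff' _ (n + 1 + 1) (n + 1) n (by simp) (by simp)]
          refine (ShortComplex.exact_iff_of_iso ?_).2 (hex'' n)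
          exact ShortComplex.isoMk (Iso.refl _) (Iso.refl _) (Iso.refl _)
            ((Category.id_comp _).trans ((d_eq (n + 1)).symm.trans (Category.comp_id _).symm))
            ((Category.id_comp _).trans ((d_eq n).symm.trans (Category.comp_id _).symm))
        · apply ChainComplex.exactAt_succ_single_obj⟩ }

/-- If every object with property `S n` is a quotient of a projective object with property `T n`
whose kernel has property `S (n + 1)`, then every object with property `S 0` has a projective
resolution with terms satisfying `T`. -/
lemma exists_projectiveResolution (S T : ℕ → ObjectProperty 𝒜)
    (step : ∀ n M, S n M → ∃ (Q : 𝒜) (p : Q ⟶ M),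
      Projective Q ∧ Epi p ∧ T n Q ∧ S (n + 1) (kernel p))
    (M : 𝒜) (hM : S 0 M) :
    ∃ R : ProjectiveResolution M, ∀ n, T n (R.complex.X n) := by
  choose Q p hQ hp hT hS using step
  -- Iterated kernels, each carried with its proof of `S n`, so that the next cover can be chosen.
  let st : ∀ n, { M : 𝒜 // S n M } := fun n =>
    Nat.rec ⟨M, hM⟩ (fun n s => ⟨kernel (p n s.1 s.2), hS n s.1 s.2⟩) n
  exact ⟨resolutionOfSyzygies (fun n => (st n).1) (fun n => Q n _ (st n).2)
    (fun n => hQ n _ _) (fun n => p n _ _) (fun n => hp n _ _)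
    (fun n => kernel.ι (p n _ (st n).2)) (fun n => inferInstanceAs (Mono (kernel.ι _)))
    (fun n => kernel.condition _) (fun n => ShortComplex.exact_kernel _),
    fun n => hT n _ _⟩

section Ext

variable [HasExt.{w} 𝒜]

lemma ext_subsingleton_of_iso {X X' Y : 𝒜} (e : X ≅ X') {n : ℕ} [Subsingleton (Ext.{w} X Y n)] :
    Subsingleton (Ext.{w} X' Y n) :=
  subsingleton_of_forall_eq 0 fun x => by
    have h : (Ext.mk₀ e.hom).comp x (zero_add n) = 0 := Subsingleton.elim _ _
    have := congrArg (fun y => (Ext.mk₀ e.inv).comp y (zero_add n)) h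
    simpa using this

lemma ext_subsingleton_of_iso_right {X Y Y' : 𝒜} (e : Y ≅ Y') {n : ℕ}
    [Subsingleton (Ext.{w} X Y n)] : Subsingleton (Ext.{w} X Y' n) :=
  subsingleton_of_forall_eq 0 fun x => by
    have h : x.comp (Ext.mk₀ e.inv) (add_zero n) = 0 := Subsingleton.elim _ _
    have := congrArg (fun y => y.comp (Ext.mk₀ e.hom) (add_zero n)) h
    simpa using this

lemma ext_zero_subsingleton_iff {X Y : 𝒜} :
    Subsingleton (Ext.{w} X Y 0) ↔ ∀ f : X ⟶ Y, f = 0 := by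
  rw [Ext.homEquiv₀.subsingleton_congr]
  exact ⟨fun _ f => Subsingleton.elim _ _, fun h => subsingleton_of_forall_eq 0 h⟩

variable {S : ShortComplex 𝒜} (hS : S.ShortExact) (Y : 𝒜)

include hS

lemma ext_subsingleton_left {n : ℕ} [Subsingleton (Ext.{w} S.X₂ Y n)]
    [Subsingleton (Ext.{w} S.X₃ Y (n + 1))] : Subsingleton (Ext.{w} S.X₁ Y n) :=
  subsingleton_of_forall_eq 0 fun x => by
    obtain ⟨y, rfl⟩ := Ext.contravariant_sequence_exact₁ hS Y x (add_comm 1 n)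
      (Subsingleton.elim _ _)
    rw [Subsingleton.elim y 0, Ext.comp_zero]

lemma ext_subsingleton_right {n : ℕ} [Subsingleton (Ext.{w} S.X₁ Y n)]
    [Subsingleton (Ext.{w} S.X₂ Y (n + 1))] : Subsingleton (Ext.{w} S.X₃ Y (n + 1)) :=
  subsingleton_of_forall_eq 0 fun x => by
    obtain ⟨y, rfl⟩ := Ext.contravariant_sequence_exact₃ hS Y x (Subsingleton.elim _ _)
      (add_comm 1 n)
    rw [Subsingleton.elim y 0, Ext.comp_zero]

/-- With projective middle term, `Ext¹(S.X₃, Y)` is the cokernel of `Hom(S.X₂, Y) ⟶ Hom(S.X₁, Y)`.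
-/
lemma ext_one_subsingleton_iff [Projective S.X₂] :
    Subsingleton (Ext.{w} S.X₃ Y 1) ↔ ∀ f : S.X₁ ⟶ Y, ∃ g : S.X₂ ⟶ Y, S.f ≫ g = f := by
  have := Ext.subsingleton_of_projective S.X₂ Y 0
  constructor
  · intro _ f
    obtain ⟨y, hy⟩ := Ext.contravariant_sequence_exact₁ hS Y (Ext.mk₀ f) (add_zero 1)
      (Subsingleton.elim _ _)
    obtain ⟨g, rfl⟩ := (Ext.mk₀_bijective _ _).2 y
    rw [Ext.mk₀_comp_mk₀] at hy
    exact ⟨g, (Ext.mk₀_bijective _ _).1 hy⟩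
  · intro h
    refine subsingleton_of_forall_eq 0 fun x => ?_
    obtain ⟨y, rfl⟩ := Ext.contravariant_sequence_exact₃ hS Y x (Subsingleton.elim _ _)
      (add_zero 1)
    obtain ⟨f, rfl⟩ := (Ext.mk₀_bijective _ _).2 y
    obtain ⟨g, rfl⟩ := h f
    rw [← Ext.mk₀_comp_mk₀, hS.extClass_comp_assoc]

end Ext

section Coproducts

variable {J : Type w'} [HasColimitsOfShape (Discrete J) 𝒜]
  [HasExactColimitsOfShape (Discrete J) 𝒜]

/-- Coproducts of short exact sequences are short exact if coproducts are exact. -/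
lemma shortExact_sigma (S : J → ShortComplex 𝒜) (hS : ∀ j, (S j).ShortExact) :
    (ShortComplex.mk (Limits.Sigma.map fun j => (S j).f) (Limits.Sigma.map fun j => (S j).g)
      (by ext j; simp)).ShortExact := by
  let T : ShortComplex (Discrete J ⥤ 𝒜) :=
    { X₁ := Discrete.functor fun j => (S j).X₁
      X₂ := Discrete.functor fun j => (S j).X₂
      X₃ := Discrete.functor fun j => (S j).X₃
      f := Discrete.natTrans fun j => (S j.as).f
      g := Discrete.natTrans fun j => (S j.as).g
      zero := by ext j; exact (S j.as).zero }
  have hT : T.ShortExact := by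
    have : Mono T.f := by
      have (j : Discrete J) : Mono (T.f.app j) := (hS j.as).mono_f
      exact NatTrans.mono_of_mono_app _
    have : Epi T.g := by
      have (j : Discrete J) : Epi (T.g.app j) := (hS j.as).epi_g
      exact NatTrans.epi_of_epi_app _
    refine .mk' ?_ ‹_› ‹_›
    -- Kernels of natural transformations are computed pointwise.
    refine T.exact_of_f_is_kernel (evaluationJointlyReflectsLimits _ fun j => ?_)
    exact (isLimitMapConeForkEquiv' _ _).symm (hS j.as).fIsKernel
  exact hT.map_of_exact colim

variable [HasExt.{w} 𝒜] [EnoughProjectives 𝒜]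

/-- Coproducts of projective presentations are again such, coproducts being exact. In degree one the
extensions of maps to the projective terms are glued by the universal property; higher degrees
follow by dimension shifting. -/
lemma ext_sigma_subsingleton (M : J → 𝒜) (Y : 𝒜) (n : ℕ)
    (h : ∀ j, Subsingleton (Ext.{w} (M j) Y (n + 1))) :
    Subsingleton (Ext.{w} (∐ M) Y (n + 1)) := by
  induction n generalizing M with
  | zero =>
    let S (j : J) : ShortComplex 𝒜 := .mk _ _ (kernel.condition (Projective.π (M j)))
    have hS (j : J) : (S j).ShortExact := { exact := ShortComplex.exact_kernel _ }
    have : Projective (∐ fun j => (S j).X₂) :=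
      projective_sigma _ fun j => Projective.projective_over (M j)
    have hs := shortExact_sigma S hS
    refine (ext_one_subsingleton_iff hs Y).2 fun f => ?_
    have (j : J) : ∃ g : (S j).X₂ ⟶ Y, (S j).f ≫ g = Sigma.ι (fun j => (S j).X₁) j ≫ f := by
      have : Projective (S j).X₂ := Projective.projective_over (M j)
      exact (ext_one_subsingleton_iff (hS j) Y).1 (h j) _
    choose g hg using this
    refine ⟨Sigma.desc g, ?_⟩
    ext j
    simp [hg]
  | succ n ih =>
    let S (j : J) : ShortComplex 𝒜 := .mk _ _ (kernel.condition (Projective.π (M j)))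
    have hS (j : J) : (S j).ShortExact := { exact := ShortComplex.exact_kernel _ }
    have hP (j : J) : Projective (S j).X₂ := Projective.projective_over (M j)
    have : Projective (∐ fun j => (S j).X₂) := projective_sigma _ hP
    have h1 : Subsingleton (Ext.{w} (∐ fun j => (S j).X₁) Y (n + 1)) := ih _ fun j => by
      have := Ext.subsingleton_of_projective (S j).X₂ Y n
      have : Subsingleton (Ext.{w} (S j).X₃ Y (n + 1 + 1)) := h j
      exact ext_subsingleton_left (hS j) Y
    have h2 := Ext.subsingleton_of_projective (∐ fun j => (S j).X₂) Y (n + 1)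
    exact @ext_subsingleton_right _ _ _ _ _ (shortExact_sigma S hS) Y _ h1 h2

end Coproducts

section Map

variable {ℬ : Type u₂} [Category.{v'} ℬ] [Abelian ℬ] [HasExt.{w} 𝒜] [HasExt.{w'} ℬ]
  (F : 𝒜 ⥤ ℬ) [F.Additive] [PreservesFiniteLimits F] [PreservesFiniteColimits F]

attribute [local simp] Ext.mapExactFunctor_comp Ext.mapExactFunctor_mk₀
  Ext.mapExactFunctor_extClass

/-- A fully faithful exact functor induces bijections on `Ext` up to degree `m` if there are enough
projective objects whose images have no higher extensions by objects in the image, up to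
degree `m`. -/
lemma mapExt_bijective_of_le [F.Full] [F.Faithful] (m : ℕ∞) (Y : 𝒜)
    (hF : ∀ X : 𝒜, ∃ (Q : 𝒜) (p : Q ⟶ X), Projective Q ∧ Epi p ∧
      ∀ n : ℕ, ((n + 1 : ℕ) : ℕ∞) ≤ m → Subsingleton (Ext.{w'} (F.obj Q) (F.obj Y) (n + 1)))
    (X : 𝒜) (n : ℕ) (hn : (n : ℕ∞) ≤ m) :
    Function.Bijective (F.mapExtAddHom X Y n) := by
  induction n generalizing X with
  | zero =>
    simpa [Ext.mapExactFunctor₀] using ⟨Functor.map_injective F, Functor.map_surjective F⟩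
  | succ n ih =>
    replace ih := fun X => ih X (le_trans (by exact_mod_cast n.le_succ) hn)
    obtain ⟨Q, p, hQ, hp, hext⟩ := hF X
    let S := ShortComplex.mk _ _ (kernel.condition p)
    have hS : S.ShortExact := { exact := ShortComplex.exact_kernel p }
    have : Subsingleton (Ext.{w} S.X₂ Y (n + 1)) := Ext.subsingleton_of_projective Q Y n
    have : Subsingleton (Ext.{w'} (S.map F).X₂ (F.obj Y) (n + 1)) := hext n hn
    -- On both sides the middle term has no `Ext` in degree `n + 1`, so `Ext^(n+1)` of the quotient
    -- is the cokernel of a map between groups `Ext^n`, where the induction hypothesis applies.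
    exact AddMonoidHom.bijective_of_surjective_of_bijective_of_right_exact _ _ _ _
      (F.mapExtAddHom S.X₂ Y n) (F.mapExtAddHom S.X₁ Y n) (F.mapExtAddHom S.X₃ Y (n + 1))
      (by cat_disch) (by cat_disch)
      ((ShortComplex.ab_exact_iff_function_exact _).1
        (Ext.contravariant_sequence_exact₁' hS Y n (n + 1) (add_comm 1 n)))
      ((ShortComplex.ab_exact_iff_function_exact _).1
        (Ext.contravariant_sequence_exact₁' (hS.map F) (F.obj Y) n (n + 1) (add_comm 1 n)))
      (ih _).surjective (ih _)
      (fun x₃ ↦ Ext.contravariant_sequence_exact₃ hS _ x₃ (by subsingleton) (add_comm 1 n))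
      (fun y₃ ↦ Ext.contravariant_sequence_exact₃ (hS.map F) _ y₃ (by subsingleton) (add_comm 1 n))

end Map

end AbelianCategories

/-! ### Pointwise exactness, the Yoneda lemma and projectives in `Mod(C)` -/

section ModuleCategory

variable {C : Type u} [SmallCategory C] [Preadditive C]

lemma comp_app_apply {M N L : CMod C} (f : M ⟶ N) (g : N ⟶ L) (X : C) (x : M.obj.obj X) :
    ((f ≫ g).hom.app X).hom x = (g.hom.app X).hom ((f.hom.app X).hom x) := rfl

lemma naturality_apply {M N : CMod C} (f : M ⟶ N) {X Y : C} (h : X ⟶ Y) (x : M.obj.obj X) :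
    (f.hom.app Y).hom ((M.obj.map h).hom x) = (N.obj.map h).hom ((f.hom.app X).hom x) :=
  congrArg (fun k => k.hom x) (f.hom.naturality h)

lemma map_comp_apply (M : CMod C) {X Y Z : C} (f : X ⟶ Y) (g : Y ⟶ Z) (x : M.obj.obj X) :
    (M.obj.map (f ≫ g)).hom x = (M.obj.map g).hom ((M.obj.map f).hom x) := by
  rw [M.obj.map_comp]; rfl

lemma map_id_apply (M : CMod C) (X : C) (x : M.obj.obj X) :
    (M.obj.map (𝟙 X)).hom x = x := by
  rw [M.obj.map_id]; rfl

lemma map_add_apply (M : CMod C) {X Y : C} (f g : X ⟶ Y) (x : M.obj.obj X) :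
    (M.obj.map (f + g)).hom x = (M.obj.map f).hom x + (M.obj.map g).hom x := by
  rw [M.obj.map_add]; rfl

lemma map_zero_apply (M : CMod C) {X Y : C} (x : M.obj.obj X) :
    (M.obj.map (0 : X ⟶ Y)).hom x = 0 := by
  rw [M.obj.map_zero]; rfl

lemma map_sum_apply (M : CMod C) {X Y : C} {ι : Type*} (s : Finset ι) (f : ι → (X ⟶ Y))
    (x : M.obj.obj X) :
    (M.obj.map (∑ i ∈ s, f i)).hom x = ∑ i ∈ s, (M.obj.map (f i)).hom x := by
  classical
  induction s using Finset.induction_on with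
  | empty => simp
  | insert i s hi ih => rw [Finset.sum_insert hi, Finset.sum_insert hi, map_add_apply, ih]

lemma hom_ext_apply {M N : CMod C} {f g : M ⟶ N}
    (h : ∀ X (x : M.obj.obj X), (f.hom.app X).hom x = (g.hom.app X).hom x) : f = g := by
  apply ObjectProperty.hom_ext
  ext X x
  exact h X x

/-- Evaluation of modules at an object. -/
abbrev ev (X : C) : CMod C ⥤ AddCommGrpCat.{u} :=
  AdditiveFunctor.forget C AddCommGrpCat.{u} ⋙ (evaluation C AddCommGrpCat.{u}).obj X

instance (X : C) : PreservesFiniteLimits (ev X) := comp_preservesFiniteLimits _ _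

instance (X : C) : PreservesFiniteColimits (ev X) := comp_preservesFiniteColimits _ _

lemma app_surjective {M N : CMod C} (f : M ⟶ N) [Epi f] (X : C) :
    Function.Surjective (f.hom.app X).hom :=
  (AddCommGrpCat.epi_iff_surjective _).1 (inferInstanceAs (Epi ((ev X).map f)))

lemma app_injective {M N : CMod C} (f : M ⟶ N) [Mono f] (X : C) :
    Function.Injective (f.hom.app X).hom :=
  (AddCommGrpCat.mono_iff_injective _).1 (inferInstanceAs (Mono ((ev X).map f)))

lemma epi_of_app_surjective {M N : CMod C} (f : M ⟶ N)
    (h : ∀ X, Function.Surjective (f.hom.app X).hom) : Epi f := by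
  have (X : C) : Epi (f.hom.app X) := (AddCommGrpCat.epi_iff_surjective _).2 (h X)
  have : Epi ((AdditiveFunctor.forget C AddCommGrpCat.{u}).map f) :=
    NatTrans.epi_of_epi_app f.hom
  exact Functor.epi_of_epi_map _ this

lemma mono_of_app_injective {M N : CMod C} (f : M ⟶ N)
    (h : ∀ X, Function.Injective (f.hom.app X).hom) : Mono f := by
  have (X : C) : Mono (f.hom.app X) := (AddCommGrpCat.mono_iff_injective _).2 (h X)
  have : Mono ((AdditiveFunctor.forget C AddCommGrpCat.{u}).map f) :=
    NatTrans.mono_of_mono_app f.hom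
  exact Functor.mono_of_mono_map _ this

lemma exact_app {S : ShortComplex (CMod C)} (hS : S.Exact) {X : C} {x : S.X₂.obj.obj X}
    (hx : (S.g.hom.app X).hom x = 0) : ∃ y, (S.f.hom.app X).hom y = x :=
  (ShortComplex.ab_exact_iff _).1 (hS.map (ev X)) x hx

lemma exact_of_app {S : ShortComplex (CMod C)}
    (h : ∀ X (x : S.X₂.obj.obj X), (S.g.hom.app X).hom x = 0 → ∃ y, (S.f.hom.app X).hom y = x) :
    S.Exact := by
  rw [S.exact_iff_epi_kernel_lift]
  refine epi_of_app_surjective _ fun X z => ?_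
  have hι := app_injective (kernel.ι S.g) X
  obtain ⟨y, hy⟩ := h X (((kernel.ι S.g).hom.app X).hom z) (by
    rw [← comp_app_apply, kernel.condition]; rfl)
  refine ⟨y, hι ?_⟩
  rw [← hy, ← comp_app_apply, kernel.lift_ι]

/-- The morphism `Hom_C(X, -) ⟶ M` corresponding to an element of `M(X)`. -/
def repHom (M : CMod C) {X : C} (x : M.obj.obj X) : rep X ⟶ M :=
  ObjectProperty.homMk
    { app := fun Y => AddCommGrpCat.ofHom
        { toFun := fun f : X ⟶ Y => (M.obj.map f).hom x
          map_zero' := map_zero_apply M x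
          map_add' := fun f g => map_add_apply M f g x }
      naturality := fun Y Z h => by
        ext f
        exact map_comp_apply M (show X ⟶ Y from f) h x }

/-- Morphisms `X ⟶ Y` as elements of the module `Hom_C(X, -)` at `Y`. -/
def toRep {X Y : C} : (X ⟶ Y) ≃+ (rep X).obj.obj Y := AddEquiv.refl _

lemma rep_map_toRep {X Y Z : C} (f : X ⟶ Y) (g : Y ⟶ Z) :
    ((rep X).obj.map g).hom (toRep f) = toRep (f ≫ g) := rfl

lemma repHom_app (M : CMod C) {X : C} (x : M.obj.obj X) {Y : C} (f : X ⟶ Y) :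
    ((repHom M x).hom.app Y).hom (toRep f) = (M.obj.map f).hom x := rfl

lemma repHom_app_id (M : CMod C) {X : C} (x : M.obj.obj X) :
    ((repHom M x).hom.app X).hom (toRep (𝟙 X)) = x := map_id_apply M X x

lemma rep_hom_apply {M : CMod C} {X : C} (φ : rep X ⟶ M) {Y : C} (f : X ⟶ Y) :
    (φ.hom.app Y).hom (toRep f) = (M.obj.map f).hom ((φ.hom.app X).hom (toRep (𝟙 X))) := by
  rw [← naturality_apply φ f, rep_map_toRep, Category.id_comp]

lemma rep_hom_ext {M : CMod C} {X : C} {φ ψ : rep X ⟶ M}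
    (h : (φ.hom.app X).hom (toRep (𝟙 X)) = (ψ.hom.app X).hom (toRep (𝟙 X))) : φ = ψ :=
  hom_ext_apply fun Y f => by
    obtain ⟨f, rfl⟩ := toRep.surjective f
    rw [rep_hom_apply φ f, rep_hom_apply ψ f, h]

lemma rep_hom_eq_zero {M : CMod C} {X : C} (h : Subsingleton (M.obj.obj X)) (φ : rep X ⟶ M) :
    φ = 0 := rep_hom_ext (Subsingleton.elim _ _)

instance rep_projective (X : C) : Projective (rep X) where
  factors {M N} f e _ := by
    obtain ⟨y, hy⟩ := app_surjective e X ((f.hom.app X).hom (toRep (𝟙 X)))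
    refine ⟨repHom _ y, rep_hom_ext ?_⟩
    rw [comp_app_apply, repHom_app_id, hy]

section Coproducts

variable (J : Type u)

instance : (additiveFunctor C AddCommGrpCat.{u}).IsClosedUnderColimitsOfShape (Discrete J) where
  colimitsOfShape_le := by
    rintro _ ⟨p⟩
    exact additive_of_isColimit p.isColimit p.prop_diag_obj

instance : HasColimitsOfShape (Discrete J) (CMod C) :=
  inferInstanceAs (HasColimitsOfShape (Discrete J)
    (additiveFunctor C AddCommGrpCat.{u}).FullSubcategory)

instance : PreservesColimitsOfShape (Discrete J) (AdditiveFunctor.forget C AddCommGrpCat.{u}) :=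
  inferInstanceAs (PreservesColimitsOfShape (Discrete J)
    (additiveFunctor C AddCommGrpCat.{u}).ι)

instance : HasExactColimitsOfShape (Discrete J) AddCommGrpCat.{u} :=
  (AB4.of_AB5 AddCommGrpCat.{u}).ofShape J

instance : HasExactColimitsOfShape (Discrete J) (CMod C) :=
  HasExactColimitsOfShape.domain_of_functor (Discrete J)
    (AdditiveFunctor.forget C AddCommGrpCat.{u})

end Coproducts

/-- Every module is a quotient of a coproduct of representable modules. -/
lemma exists_epi_sigma_rep (M : CMod C) :
    ∃ (J : Type u) (X : J → C) (p : (∐ fun j => rep (X j)) ⟶ M), Epi p := by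
  -- One summand for each element of `M`; the identity in the summand of `x` hits `x`.
  refine ⟨Σ X : C, M.obj.obj X, Sigma.fst, Sigma.desc fun j => repHom M j.2,
    epi_of_app_surjective _ fun X x => ?_⟩
  refine ⟨((Sigma.ι (fun j : Σ X : C, M.obj.obj X => rep j.1) ⟨X, x⟩).hom.app X).hom (toRep (𝟙 X)), ?_⟩
  rw [← comp_app_apply, Sigma.ι_desc]
  exact repHom_app_id M x

instance : EnoughProjectives (CMod C) where
  presentation M := by
    obtain ⟨J, X, p, hp⟩ := exists_epi_sigma_rep M
    exact ⟨{ p := _, f := p, epi := hp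
             projective := projective_sigma _ fun j => rep_projective (X j) }⟩

end ModuleCategory

/-! ### Modules over `C/I` and the `Ext` criterion for idempotence -/

namespace CatIdeal

open Abelian

variable {C : Type u} [SmallCategory C] [Preadditive C] (I : CatIdeal C)

lemma proj_map_eq_zero_iff {X Y : C} (f : X ⟶ Y) : I.proj.map f = 0 ↔ f ∈ I.hom X Y := by
  rw [← I.proj.map_zero, Quotient.functor_map_eq_iff]
  simp [rel]

instance : I.pushforward.Faithful where
  map_injective {F G f g} h := by
    apply ObjectProperty.hom_ext
    ext ⟨X⟩ x
    exact congrArg (fun k : I.pushforward.obj F ⟶ I.pushforward.obj G => (k.hom.app X).hom x) h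

instance : I.pushforward.Full where
  map_surjective {F G} φ := by
    refine ⟨ObjectProperty.homMk { app := fun X => φ.hom.app X.as, naturality := ?_ }, rfl⟩
    rintro ⟨X⟩ ⟨Y⟩ f
    -- Since `π` is full, naturality over `C/I` can be tested on representatives in `C`.
    obtain ⟨f, rfl⟩ := I.proj.map_surjective f
    exact φ.hom.naturality f

lemma pushforward_map_eq_zero (F : CMod I.Quot) {X Y : C} {f : X ⟶ Y} (hf : f ∈ I.hom X Y)
    (x : (I.pushforward.obj F).obj.obj X) : ((I.pushforward.obj F).obj.map f).hom x = 0 := by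
  have : (I.pushforward.obj F).obj.map f = F.obj.map (I.proj.map f) := rfl
  rw [this, (I.proj_map_eq_zero_iff f).2 hf]
  exact map_zero_apply F x

/-- A module annihilated by `I` comes from a module over `C/I`. -/
lemma exists_pushforward_iso (M : CMod C)
    (hM : ∀ (X Y : C) (f : X ⟶ Y), f ∈ I.hom X Y → M.obj.map f = 0) :
    ∃ F : CMod I.Quot, Nonempty (I.pushforward.obj F ≅ M) := by
  have hrel (X Y : C) (f g : X ⟶ Y) (h : I.rel f g) : M.obj.map f = M.obj.map g := by
    rw [← sub_eq_zero, ← M.obj.map_sub]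
    exact hM _ _ _ h
  let F₀ : I.Quot ⥤ AddCommGrpCat.{u} := CategoryTheory.Quotient.lift I.rel M.obj hrel
  have hF₀ : F₀.Additive := by
    refine ⟨fun {X Y f g} => ?_⟩
    obtain ⟨X⟩ := X
    obtain ⟨Y⟩ := Y
    obtain ⟨f, rfl⟩ := I.proj.map_surjective f
    obtain ⟨g, rfl⟩ := I.proj.map_surjective g
    rw [← I.proj.map_add]
    exact M.obj.map_add
  exact ⟨⟨F₀, hF₀⟩, ⟨ObjectProperty.isoMk _ (CategoryTheory.Quotient.lift.isLift I.rel M.obj hrel)⟩⟩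

instance (J : Type u) : PreservesColimitsOfShape (Discrete J) I.pushforward :=
  have : PreservesColimitsOfShape (Discrete J)
      (I.pushforward ⋙ AdditiveFunctor.forget C AddCommGrpCat.{u}) :=
    inferInstanceAs (PreservesColimitsOfShape (Discrete J)
      (AdditiveFunctor.forget I.Quot AddCommGrpCat.{u} ⋙
        (Functor.whiskeringLeft C I.Quot AddCommGrpCat.{u}).obj I.proj))
  preservesColimitsOfShape_of_reflects_of_preserves _
    (AdditiveFunctor.forget C AddCommGrpCat.{u})

/-- The inclusion `I(X, -) ⟶ Hom_C(X, -)`. -/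
def incl (X : C) : I.module X ⟶ rep X :=
  ObjectProperty.homMk
    { app := fun Y => AddCommGrpCat.ofHom (I.hom X Y).subtype
      naturality := fun _ _ _ => rfl }

/-- The projection `Hom_C(X, -) ⟶ Hom_{C/I}(X, -)`. -/
def repProj (X : C) : rep X ⟶ I.pushforward.obj (rep (I.proj.obj X)) :=
  repHom _ (show (I.pushforward.obj (rep (I.proj.obj X))).obj.obj X from
    toRep (𝟙 (I.proj.obj X)))

lemma incl_app {X Y : C} (f : (I.module X).obj.obj Y) :
    ∃ g ∈ I.hom X Y, ((I.incl X).hom.app Y).hom f = toRep g :=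
  ⟨f.1, f.2, rfl⟩

lemma exists_incl_app {X Y : C} {g : X ⟶ Y} (hg : g ∈ I.hom X Y) :
    ∃ f, ((I.incl X).hom.app Y).hom f = toRep g :=
  ⟨⟨g, hg⟩, rfl⟩

lemma repProj_app {X Y : C} (f : X ⟶ Y) :
    ((I.repProj X).hom.app Y).hom (toRep f) = toRep (I.proj.map f) :=
  congrArg toRep (Category.id_comp (I.proj.map f))

lemma repProj_app_eq_zero_iff {X Y : C} (f : X ⟶ Y) :
    ((I.repProj X).hom.app Y).hom (toRep f) = 0 ↔ f ∈ I.hom X Y := by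
  rw [← proj_map_eq_zero_iff, repProj_app]
  exact Iff.rfl

/-- The sequence `I(X, -) ⟶ Hom_C(X, -) ⟶ Hom_{C/I}(X, -)`. -/
def sequence (X : C) : ShortComplex (CMod C) where
  f := I.incl X
  g := I.repProj X
  zero := hom_ext_apply fun Y f => by
    obtain ⟨g, hg, h⟩ := I.incl_app f
    rw [comp_app_apply, h, (I.repProj_app_eq_zero_iff g).2 hg]
    rfl

lemma sequence_shortExact (X : C) : (I.sequence X).ShortExact where
  exact := exact_of_app fun Y f hf => by
    obtain ⟨f, rfl⟩ := toRep.surjective f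
    exact I.exists_incl_app ((I.repProj_app_eq_zero_iff f).1 hf)
  mono_f := mono_of_app_injective _ fun _ => Subtype.val_injective
  epi_g := epi_of_app_surjective _ fun Y f => by
    obtain ⟨f, rfl⟩ := (toRep (X := I.proj.obj X) (Y := I.proj.obj Y)).surjective f
    obtain ⟨f, rfl⟩ := I.proj.map_surjective f
    exact ⟨toRep f, I.repProj_app f⟩

instance (X : C) : Projective (I.sequence X).X₂ := rep_projective X

/-- By Yoneda `g` sends `f` to `F(f)` applied to a fixed element, and morphisms in `I` act as zero
on `π_* F`. -/
lemma incl_comp_eq_zero {X : C} {F : CMod I.Quot} (g : rep X ⟶ I.pushforward.obj F) :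
    I.incl X ≫ g = 0 := hom_ext_apply fun Y f => by
  obtain ⟨f', hf, h⟩ := I.incl_app f
  rw [comp_app_apply, h, rep_hom_apply, I.pushforward_map_eq_zero F hf]
  rfl

/-- `I` is `(k + 1)`-idempotent if and only if `Ext^n(I(X, -), π_* F) = 0` for all `n ≤ k`. -/
theorem isKIdempotent_add_one_iff (k : ℕ∞) :
    I.IsKIdempotent (k + 1) ↔ ∀ (X : C) (F : CMod I.Quot) (n : ℕ), (n : ℕ∞) ≤ k →
      Subsingleton (Ext (I.module X) (I.pushforward.obj F) n) := by
  constructor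
  · intro h X F n hn
    have hext : Subsingleton (Ext (I.sequence X).X₃ (I.pushforward.obj F) (n + 1)) := by
      have := Ext.subsingleton_of_projective (rep (I.proj.obj X)) F n
      -- The source of this surjective comparison map is zero, as representables over `C/I` are
      -- projective.
      exact (h (n + 1) (by push_cast; gcongr) (rep (I.proj.obj X)) F).2.subsingleton
    cases n with
    | zero =>
      refine ext_zero_subsingleton_iff.2 fun f => ?_
      -- Every map `I(X, -) ⟶ π_* F` extends to `Hom_C(X, -)`, hence is zero.
      obtain ⟨g, rfl⟩ := (ext_one_subsingleton_iff (I.sequence_shortExact X) _).1 hext f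
      exact I.incl_comp_eq_zero g
    | succ n =>
      have := Ext.subsingleton_of_projective (I.sequence X).X₂ (I.pushforward.obj F) n
      exact ext_subsingleton_left (I.sequence_shortExact X) _
  · intro h n hn F F'
    refine mapExt_bijective_of_le I.pushforward (k + 1) F' (fun X => ?_) F n hn
    obtain ⟨J, Y, p, hp⟩ := exists_epi_sigma_rep X
    refine ⟨_, p, projective_sigma _ fun j => rep_projective _, hp, fun n hn => ?_⟩
    have (j : J) : Subsingleton
        (Ext (I.pushforward.obj (rep (Y j))) (I.pushforward.obj F') (n + 1)) := by
      have : Subsingleton (Ext (I.sequence (Y j).as).X₁ (I.pushforward.obj F') n) :=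
        h _ _ _ ((ENat.add_le_add_iff_right ENat.one_ne_top).1 (by exact_mod_cast hn))
      have := Ext.subsingleton_of_projective (I.sequence (Y j).as).X₂ (I.pushforward.obj F') n
      exact ext_subsingleton_right (I.sequence_shortExact (Y j).as) _
    have := ext_sigma_subsingleton _ _ _ this
    exact ext_subsingleton_of_iso (PreservesCoproduct.iso I.pushforward fun j => rep (Y j)).symm

end CatIdeal

/-! ### Trace ideals and modules vanishing at `A` -/

section Trace

variable {C : Type u} [SmallCategory C] [Preadditive C] (A : C)

lemma comp_mem_ofTrace {X Y : C} (a : X ⟶ A) (g : A ⟶ Y) :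
    a ≫ g ∈ (CatIdeal.ofTrace (rep A)).hom X Y :=
  AddSubgroup.mem_iSup_of_mem (repHom (rep X) (toRep a)) ⟨toRep g, rfl⟩

/-- By Yoneda each map `Hom_C(A, -) ⟶ Hom_C(X, -)` is precomposition with some `a : X ⟶ A`, so the
trace ideal is generated by the morphisms factoring through `A`. -/
lemma ofTrace_hom_le {X Y : C} {H : AddSubgroup (X ⟶ Y)}
    (h : ∀ (a : X ⟶ A) (g : A ⟶ Y), a ≫ g ∈ H) : (CatIdeal.ofTrace (rep A)).hom X Y ≤ H := by
  refine iSup_le fun φ => ?_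
  rintro _ ⟨g, rfl⟩
  obtain ⟨g, rfl⟩ := toRep.surjective g
  rw [rep_hom_apply]
  exact h _ g

lemma subsingleton_pushforward_obj (F : CMod (CatIdeal.ofTrace (rep A)).Quot) :
    Subsingleton (((CatIdeal.ofTrace (rep A)).pushforward.obj F).obj.obj A) :=
  subsingleton_of_forall_eq 0 fun x => by
    rw [← map_id_apply _ A x]
    refine CatIdeal.pushforward_map_eq_zero _ F ?_ x
    simpa using comp_mem_ofTrace A (𝟙 A) (𝟙 A)

/-- The modules over `C/I`, for `I` the trace ideal of `Hom_C(A, -)`, are the modules over `C` that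
vanish at `A`. -/
lemma exists_pushforward_iso_of_subsingleton (M : CMod C) (hM : Subsingleton (M.obj.obj A)) :
    ∃ F : CMod (CatIdeal.ofTrace (rep A)).Quot,
      Nonempty ((CatIdeal.ofTrace (rep A)).pushforward.obj F ≅ M) := by
  refine CatIdeal.exists_pushforward_iso _ M fun X Y f hf => ?_
  refine ofTrace_hom_le A (H := (M.obj.mapAddHom (X := X) (Y := Y)).ker) (fun a g => ?_) hf
  change M.obj.map (a ≫ g) = 0
  ext x
  rw [map_comp_apply, Subsingleton.elim ((M.obj.map a).hom x) 0, map_zero]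
  rfl

end Trace

/-! ### Finitely presented modules -/

section FinitelyPresented

variable {C : Type u} [SmallCategory C] [Preadditive C]

/-- The morphism `Hom_C(Y, -) ⟶ Hom_C(X, -)` given by precomposition with `g : X ⟶ Y`. -/
def repMap {X Y : C} (g : X ⟶ Y) : rep Y ⟶ rep X := repHom (rep X) (toRep g)

lemma repMap_app {X Y Z : C} (g : X ⟶ Y) (f : Y ⟶ Z) :
    ((repMap g).hom.app Z).hom (toRep f) = toRep (g ≫ f) := rfl

lemma exists_repMap_eq {X Y : C} (φ : rep Y ⟶ rep X) : ∃ g, repMap g = φ := by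
  obtain ⟨g, hg⟩ := toRep.surjective ((φ.hom.app Y).hom (toRep (𝟙 Y)))
  refine ⟨g, rep_hom_ext ?_⟩
  rw [repMap_app, Category.comp_id, hg]

lemma repMap_id (X : C) : repMap (𝟙 X) = 𝟙 (rep X) :=
  rep_hom_ext (by rw [repMap_app, Category.comp_id]; rfl)

lemma repMap_comp {X Y Z : C} (f : X ⟶ Y) (g : Y ⟶ Z) :
    repMap g ≫ repMap f = repMap (f ≫ g) :=
  rep_hom_ext (by rw [comp_app_apply]; simp only [repMap_app, Category.comp_id])

lemma repMap_zero {X Y : C} : repMap (0 : X ⟶ Y) = 0 :=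
  rep_hom_ext (by rw [repMap_app, zero_comp]; rfl)

lemma repMap_sum {X Y : C} {ι : Type*} (s : Finset ι) (f : ι → (X ⟶ Y)) :
    repMap (∑ i ∈ s, f i) = ∑ i ∈ s, repMap (f i) := by
  let φ : (X ⟶ Y) →+ (rep Y ⟶ rep X) :=
    { toFun := repMap
      map_zero' := repMap_zero
      map_add' := fun f g => rep_hom_ext (by
        simp only [repMap_app, Category.comp_id]
        exact (toRep.map_add f g).trans
          (congrArg₂ (· + ·) (congrArg toRep (Category.comp_id f)).symm
            (congrArg toRep (Category.comp_id g)).symm)) }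
  exact map_sum φ f s

/-- `Hom_C(A, -)ⁿ` is represented by `Aⁿ`. -/
def repBiproductIso [HasFiniteBiproducts C] (A : C) (n : ℕ) :
    rep (⨁ fun _ : Fin n => A) ≅ ⨁ fun _ : Fin n => rep A :=
  let b : Bicone fun _ : Fin n => rep A :=
    { pt := rep (⨁ fun _ : Fin n => A)
      π := fun j => repMap (biproduct.ι (fun _ : Fin n => A) j)
      ι := fun j => repMap (biproduct.π (fun _ : Fin n => A) j)
      ι_π := fun i j => by
        rw [repMap_comp]
        by_cases h : i = j
        · subst h
          simp [repMap_id]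
        · rw [biproduct.ι_π_ne _ (Ne.symm h), repMap_zero, dif_neg h] }
  biproduct.uniqueUpToIso _ (isBilimitOfTotal b (by
    change ∑ j : Fin n, repMap _ ≫ repMap _ = 𝟙 (rep _)
    simp only [repMap_comp]
    rw [← repMap_sum, biproduct.total, repMap_id]))

open ZeroObject in
lemma inAdd_rep_biproduct [HasFiniteBiproducts C] (A : C) (n : ℕ) :
    InAdd (rep A) (rep (⨁ fun _ : Fin n => A)) :=
  ⟨0, n, ⟨(isoBiprodZero (isZero_zero _)).symm ≪≫ repBiproductIso A n⟩⟩

lemma finPres_rep (X : C) : finPres C (rep X) :=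
  ⟨X, X, 0, 𝟙 _, zero_comp, (ShortComplex.exact_iff_mono _ rfl).2 inferInstance, inferInstance⟩

lemma finPres.exists_epi {M : CMod C} (hM : finPres C M) :
    ∃ (Y : C) (p : rep Y ⟶ M), Epi p := by
  obtain ⟨_, Y, _, p, _, _, hp⟩ := hM
  exact ⟨Y, p, hp⟩

/-- Generators of `S.X₃` come from those of `S.X₂`; the relations are those of `S.X₂` together with
lifts of the generators of `S.X₁`. Hence finite generation of `S.X₁` suffices. -/
lemma finPres.of_exact [HasBinaryBiproducts C] {S : ShortComplex (CMod C)} (hS : S.Exact)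
    [Epi S.g] (h₁ : ∃ (Y : C) (p : rep Y ⟶ S.X₁), Epi p) (h₂ : finPres C S.X₂) :
    finPres C S.X₃ := by
  obtain ⟨Y', p, hp⟩ := h₁
  obtain ⟨X, Y, a, b, w, hab, hb⟩ := h₂
  obtain ⟨a, rfl⟩ := exists_repMap_eq a
  obtain ⟨l, hl⟩ := exists_repMap_eq (Projective.factorThru (p ≫ S.f) b)
  have hl' : repMap l ≫ b = p ≫ S.f := by rw [hl, Projective.factorThru_comp]
  have w' : repMap (biprod.lift a l) ≫ b ≫ S.g = 0 := by
    have : biprod.lift a l = a ≫ biprod.inl + l ≫ biprod.inr := by ext <;> simp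
    have h : repMap (biprod.lift a l) =
        repMap biprod.inl ≫ repMap a + repMap biprod.inr ≫ repMap l := by
      rw [repMap_comp, repMap_comp, this]
      simpa using repMap_sum Finset.univ ![a ≫ biprod.inl, l ≫ biprod.inr]
    rw [h, Preadditive.add_comp, Category.assoc, Category.assoc, reassoc_of% w, reassoc_of% hl',
      S.zero]
    simp
  refine ⟨X ⊞ Y', Y, repMap (biprod.lift a l), b ≫ S.g, w', exact_of_app fun T f hf => ?_,
    epi_comp _ _⟩
  obtain ⟨m, hm⟩ := exact_app hS (x := (b.hom.app T).hom f) hf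
  obtain ⟨y, rfl⟩ := app_surjective p T m
  have hz : (b.hom.app T).hom (f - ((repMap l).hom.app T).hom y) = 0 := by
    rw [map_sub, ← hm, ← comp_app_apply, ← comp_app_apply, hl', sub_self]
  obtain ⟨x, hx⟩ := exact_app hab hz
  obtain ⟨x, rfl⟩ := toRep.surjective x
  obtain ⟨y, rfl⟩ := toRep.surjective y
  obtain ⟨f, rfl⟩ := toRep.surjective f
  refine ⟨toRep (biprod.desc x y), ?_⟩
  have hx' : a ≫ x = f - l ≫ y := hx
  change toRep (biprod.lift a l ≫ biprod.desc x y) = toRep f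
  rw [biprod.lift_desc, hx', sub_add_cancel]

lemma finPres.of_iso {M N : CMod C} (hM : finPres C M) (e : M ≅ N) : finPres C N := by
  obtain ⟨X, Y, a, b, w, hab, hb⟩ := hM
  refine ⟨X, Y, a, b ≫ e.hom, by rw [reassoc_of% w, zero_comp],
    (ShortComplex.exact_iff_of_iso ?_).1 hab, epi_comp _ _⟩
  exact ShortComplex.isoMk (Iso.refl _) (Iso.refl _) e

instance [HasBinaryBiproducts C] : (finPres C).IsClosedUnderCokernels where
  cokernels_le := by
    rintro _ ⟨f, k, hk, hf⟩
    have : Epi (ShortComplex.mk f k.π k.condition).g := Cofork.IsColimit.epi hk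
    refine finPres.of_exact (S := ShortComplex.mk f k.π k.condition)
      (ShortComplex.exact_of_g_is_cokernel _ ?_) hf.1.exists_epi hf.2
    exact IsColimit.ofIsoColimit hk (Cofork.ext (Iso.refl _))

/-- Kernels in `mod(C)` are kernels in `Mod(C)`. -/
lemma finPres_kernel [HasKernels (FPMod C)] {M N : CMod C} (hM : finPres C M)
    (hN : finPres C N) (φ : M ⟶ N) : finPres C (kernel φ) := by
  let φ' : (⟨M, hM⟩ : FPMod C) ⟶ ⟨N, hN⟩ := ObjectProperty.homMk φ
  have w : (kernel.ι φ').hom ≫ φ = 0 :=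
    congrArg InducedCategory.Hom.hom (kernel.condition φ')
  -- Representables are finitely presented and detect elements, so the universal property in
  -- `mod(C)` can be tested pointwise.
  have hmono : Mono (kernel.ι φ').hom := mono_of_app_injective _ fun X => by
    rw [injective_iff_map_eq_zero]
    intro y hy
    let ψ : (⟨rep X, finPres_rep X⟩ : FPMod C) ⟶ kernel φ' := ObjectProperty.homMk (repHom _ y)
    have hψ : ψ = 0 := by
      rw [← cancel_mono (kernel.ι φ'), zero_comp]
      apply ObjectProperty.hom_ext
      refine rep_hom_ext ?_
      change ((repHom _ y ≫ (kernel.ι φ').hom).hom.app X).hom _ = 0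
      rw [comp_app_apply, repHom_app_id]
      exact hy
    have h : repHom _ y = 0 := congrArg InducedCategory.Hom.hom hψ
    rw [← repHom_app_id _ y, h]
    rfl
  have hex : (ShortComplex.mk _ _ w).Exact := exact_of_app fun X x hx => by
    let ψ : (⟨rep X, finPres_rep X⟩ : FPMod C) ⟶ ⟨M, hM⟩ := ObjectProperty.homMk (repHom _ x)
    have hψ : ψ ≫ φ' = 0 := by
      apply ObjectProperty.hom_ext
      refine rep_hom_ext ?_
      change ((repHom _ x ≫ φ).hom.app X).hom _ = 0
      rw [comp_app_apply, repHom_app_id]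
      exact hx
    refine ⟨((kernel.lift φ' ψ hψ).hom.hom.app X).hom (toRep (𝟙 X)), ?_⟩
    have h : (kernel.lift φ' ψ hψ).hom ≫ (kernel.ι φ').hom = repHom _ x :=
      congrArg InducedCategory.Hom.hom (kernel.lift_ι φ' ψ hψ)
    change (((kernel.ι φ').hom).hom.app X).hom _ = x
    rw [← comp_app_apply, h, repHom_app_id]
  exact (kernel φ').property.of_iso
    (hex.fIsKernel.conePointUniqueUpToIso (limit.isLimit _))

/-- A module `M` without nonzero morphisms to modules vanishing at `A`, and such that `M(A)` is
finitely generated over `End(A)`, is a quotient of `Hom_C(Aⁿ, -)` for some `n`. -/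
lemma exists_epi_rep_biproduct [HasFiniteBiproducts C] {A : C} {M : CMod C}
    (hM : ∀ N : CMod C, Subsingleton (N.obj.obj A) → ∀ f : M ⟶ N, f = 0) {n : ℕ}
    (x : Fin n → M.obj.obj A)
    (hx : ∀ y, ∃ g : Fin n → (A ⟶ A), y = ∑ i, (M.obj.map (g i)).hom (x i)) :
    ∃ p : rep (⨁ fun _ : Fin n => A) ⟶ M, Epi p := by
  -- The map out of `Hom_C(Aⁿ, -)` whose components correspond to the `x i`. It is surjective at
  -- `A`, so its cokernel vanishes there and the projection to the cokernel is zero by `hM`.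
  let p := repHom M (∑ i, (M.obj.map (biproduct.ι (fun _ : Fin n => A) i)).hom (x i))
  refine ⟨p, Preadditive.epi_of_cokernel_zero (hM _ (subsingleton_of_forall_eq 0 fun z => ?_) _)⟩
  obtain ⟨y, rfl⟩ := app_surjective (cokernel.π p) A z
  obtain ⟨g, rfl⟩ := hx y
  have : (p.hom.app A).hom (toRep (biproduct.desc g)) =
      ∑ i, (M.obj.map (g i)).hom (x i) := by
    rw [repHom_app, map_sum]
    refine Finset.sum_congr rfl fun i _ => ?_
    rw [← map_comp_apply, biproduct.ι_desc]
  rw [← this, ← comp_app_apply, cokernel.condition]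
  rfl

end FinitelyPresented

/-! ### Finiteness over `R` and kernels from duality -/

section Linear

variable (R : Type u) [CommRing R] {C : Type u} [SmallCategory C] [Preadditive C] [Linear R C]

lemma finite_linObj_rep {X Y : C} (h : Module.Finite R (X ⟶ Y)) :
    Module.Finite R (linObj R (rep X) Y) :=
  let f : (X ⟶ Y) →ₗ[R] linObj R (rep X) Y :=
    { toFun := fun f : X ⟶ Y => (toRep f : (rep X).obj.obj Y)
      map_add' := fun _ _ => rfl
      map_smul' := fun r f => by
        change toRep (r • f) = toRep (f ≫ (r • 𝟙 Y))
        simp }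
  Module.Finite.of_surjective f fun y => ⟨y, rfl⟩

lemma finite_linObj_of_epi {M N : CMod C} (p : M ⟶ N) [Epi p] {X : C}
    (h : Module.Finite R (linObj R M X)) : Module.Finite R (linObj R N X) :=
  let f : linObj R M X →ₗ[R] linObj R N X := (((toLinear R).map p).app X).hom
  Module.Finite.of_surjective f (app_surjective p X)

lemma finite_linObj_of_mono [IsNoetherianRing R] {M N : CMod C} (i : M ⟶ N) [Mono i] {X : C}
    (h : Module.Finite R (linObj R N X)) : Module.Finite R (linObj R M X) :=
  let f : linObj R M X →ₗ[R] linObj R N X := (((toLinear R).map i).app X).hom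
  Module.Finite.of_injective f (app_injective i X)

lemma exists_generators_of_finite {M : CMod C} {A : C} (h : Module.Finite R (linObj R M A)) :
    ∃ (n : ℕ) (x : Fin n → M.obj.obj A),
      ∀ y, ∃ g : Fin n → (A ⟶ A), y = ∑ i, (M.obj.map (g i)).hom (x i) := by
  obtain ⟨n, f, hf⟩ := Module.Finite.exists_fin' R (linObj R M A)
  refine ⟨n, fun i => f fun j => if i = j then 1 else 0, fun y => ?_⟩
  obtain ⟨c, rfl⟩ := hf y
  -- `R` acts on `M(A)` through `End(A)`, so `R`-generators also generate over `End(A)`.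
  exact ⟨fun i => c i • 𝟙 A, LinearMap.pi_apply_eq_sum_univ f c⟩

variable (C)

/-- The finitely presented modules over a dualizing variety have kernels. -/
lemma IsDualizingVariety.hasKernels (hC : IsDualizingVariety R C) : HasKernels (FPMod C) := by
  obtain ⟨E, ι, _, h, _⟩ := hC.duality
  have := hC.hasFiniteBiproducts
  have : HasBinaryBiproducts C := hasBinaryBiproducts_of_finite_biproducts C
  -- Cokernels exist in `mod(Cᵒᵖ)`; the duality turns them into kernels in `mod(C)`.
  have : HasCokernels (FPMod Cᵒᵖ) := inferInstance
  have : HasCoequalizers (FPMod Cᵒᵖ) := Preadditive.hasCoequalizers_of_hasCokernels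
  have : HasCoequalizers (FPMod C)ᵒᵖ :=
    Adjunction.hasColimitsOfShape_of_equivalence (dualFP R E h)
  have : HasEqualizers (FPMod C) :=
    Adjunction.hasLimitsOfShape_of_equivalence (opOp (FPMod C))
  infer_instance

end Linear

/-! ### From vanishing of `Ext` to resolutions in `add(P)`, and back -/

section MainTheorem

open Abelian

variable {C : Type u} [SmallCategory C] [Preadditive C]

lemma subsingleton_obj_biproduct [HasFiniteBiproducts C] {A : C} (n : ℕ) (N : CMod C)
    (hN : Subsingleton (N.obj.obj A)) :
    Subsingleton (N.obj.obj (⨁ fun _ : Fin n => A)) :=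
  subsingleton_of_forall_eq 0 fun x => by
    rw [← map_id_apply N _ x, ← biproduct.total, map_sum_apply]
    refine Finset.sum_eq_zero fun i _ => ?_
    rw [map_comp_apply, Subsingleton.elim ((N.obj.map (biproduct.π _ i)).hom x) 0, map_zero]

lemma InAdd.hom_eq_zero {A : C} {Q N : CMod C} (hQ : InAdd (rep A) Q)
    (hN : Subsingleton (N.obj.obj A)) (f : Q ⟶ N) : f = 0 := by
  obtain ⟨Y, n, ⟨e⟩⟩ := hQ
  have h : e.inv ≫ biprod.fst ≫ f = 0 := by
    refine biproduct.hom_ext' _ _ fun j => ?_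
    rw [comp_zero]
    exact rep_hom_eq_zero hN _
  rw [Iso.inv_comp_eq, comp_zero] at h
  rw [← Category.id_comp f, ← biprod.inl_fst (X := Q) (Y := Y), Category.assoc, h, comp_zero]

/-- Modules in `ℙ_k` have no extensions of degree at most `k` by modules vanishing at `A`. -/
lemma InPk.ext_subsingleton {A : C} {k : ℕ∞} {M N : CMod C} (hM : InPk (rep A) k M)
    (hN : Subsingleton (N.obj.obj A)) (n : ℕ) (hn : (n : ℕ∞) ≤ k) :
    Subsingleton (Ext M N n) := by
  obtain ⟨-, Q, -, hQ⟩ := hM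
  refine subsingleton_of_forall_eq 0 fun x => ?_
  -- The class is represented by a cocycle on the `n`-th term of the resolution, which lies in
  -- `add(P)`.
  obtain ⟨f, hf, rfl⟩ := Q.extMk_surjective x (n + 1) rfl
  obtain rfl := (hQ n hn).hom_eq_zero hN f
  exact Q.extMk_zero _ _

section

variable (R : Type u) [CommRing R] [Linear R C]

/-- A finitely presented module over a dualizing variety without extensions of degree at most `k`
by modules vanishing at `A` lies in `ℙ_k`. -/
lemma inPk_of_finPres (hC : IsDualizingVariety R C) {A : C} {k : ℕ∞} {M : CMod C}
    (hM : finPres C M)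
    (hext : ∀ N : CMod C, Subsingleton (N.obj.obj A) → ∀ n : ℕ, (n : ℕ∞) ≤ k →
      Subsingleton (Ext M N n)) : InPk (rep A) k M := by
  have := hC.hasFiniteBiproducts
  have := hC.hasKernels
  -- Property of the `i`-th syzygy: each step of the resolution costs one degree of vanishing,
  -- whence the bound `i + n ≤ k`.
  let S (i : ℕ) : ObjectProperty (CMod C) := fun M => finPres C M ∧
    ∀ N : CMod C, Subsingleton (N.obj.obj A) → ∀ n : ℕ, ((i + n : ℕ) : ℕ∞) ≤ k →
      Subsingleton (Ext M N n)
  let T (i : ℕ) : ObjectProperty (CMod C) := fun Q => finPres C Q ∧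
    ((i : ℕ∞) ≤ k → InAdd (rep A) Q)
  obtain ⟨Q, hQ⟩ := exists_projectiveResolution S T (fun i M ⟨hM, hext⟩ => by
    obtain ⟨Y, p, hp, hY⟩ : ∃ (Y : C) (p : rep Y ⟶ M), Epi p ∧
        ((i : ℕ∞) ≤ k → InAdd (rep A) (rep Y)) := by
      obtain ⟨Y, p, hp⟩ := hM.exists_epi
      by_cases hi : (i : ℕ∞) ≤ k
      · obtain ⟨n, x, hx⟩ := exists_generators_of_finite R
          (finite_linObj_of_epi R p (finite_linObj_rep R (hC.hom_finite Y A)))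
        obtain ⟨q, hq⟩ := exists_epi_rep_biproduct
          (fun N hN => ext_zero_subsingleton_iff.1 (hext N hN 0 hi)) x hx
        exact ⟨_, q, hq, fun _ => inAdd_rep_biproduct A n⟩
      -- Beyond degree `k` any representable cover will do.
      · exact ⟨Y, p, hp, fun h => absurd h hi⟩
    refine ⟨rep Y, p, rep_projective Y, hp, ⟨finPres_rep Y, hY⟩,
      finPres_kernel (finPres_rep Y) hM p, fun N hN n hn => ?_⟩
    have hi : (i : ℕ∞) ≤ k := le_trans (by exact_mod_cast (by omega : i ≤ i + 1 + n)) hn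
    have hS : (ShortComplex.mk _ _ (kernel.condition p)).ShortExact :=
      { exact := ShortComplex.exact_kernel p }
    have : Subsingleton (Ext (rep Y) N n) := by
      cases n with
      | zero => exact ext_zero_subsingleton_iff.2 ((hY hi).hom_eq_zero hN)
      | succ n => exact Ext.subsingleton_of_projective _ _ _
    have : Subsingleton (Ext M N (n + 1)) := hext N hN (n + 1) (by
      rwa [show i + (n + 1) = i + 1 + n by omega])
    exact ext_subsingleton_left hS N) M ⟨hM, by simpa using hext⟩
  exact ⟨hM, Q, fun i => (hQ i).1, fun i => (hQ i).2⟩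

/-- If the module `I(X, -)` given by the trace ideal of `Hom_C(A, -)` has no homomorphisms to and
no extensions by modules vanishing at `A`, then it is finitely presented. -/
lemma finPres_module_ofTrace [IsNoetherianRing R] (hC : IsDualizingVariety R C) {A : C} (X : C)
    (hext : ∀ N : CMod C, Subsingleton (N.obj.obj A) → ∀ n : ℕ, n ≤ 1 →
      Subsingleton (Ext ((CatIdeal.ofTrace (rep A)).module X) N n)) :
    finPres C ((CatIdeal.ofTrace (rep A)).module X) := by
  have := hC.hasFiniteBiproducts
  have : HasBinaryBiproducts C := hasBinaryBiproducts_of_finite_biproducts C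
  have : Mono ((CatIdeal.ofTrace (rep A)).incl X) :=
    ((CatIdeal.ofTrace (rep A)).sequence_shortExact X).mono_f
  obtain ⟨n, x, hx⟩ := exists_generators_of_finite R
    (finite_linObj_of_mono R ((CatIdeal.ofTrace (rep A)).incl X)
      (finite_linObj_rep R (hC.hom_finite X A)))
  obtain ⟨p, hp⟩ := exists_epi_rep_biproduct
    (fun N hN => ext_zero_subsingleton_iff.1 (hext N hN 0 zero_le_one)) x hx
  have hS : (ShortComplex.mk _ _ (kernel.condition p)).ShortExact :=
    { exact := ShortComplex.exact_kernel p }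
  -- `Hom(kernel p, N)` sits between `Hom(Hom_C(Aⁿ, -), N)` and `Ext¹(I(X, -), N)`, both zero.
  have hK (N : CMod C) (hN : Subsingleton (N.obj.obj A)) (f : kernel p ⟶ N) : f = 0 := by
    have : Subsingleton (Ext (rep (⨁ fun _ : Fin n => A)) N 0) :=
      ext_zero_subsingleton_iff.2 (rep_hom_eq_zero (subsingleton_obj_biproduct n N hN))
    have := hext N hN (0 + 1) le_rfl
    exact ext_zero_subsingleton_iff.1 (ext_subsingleton_left hS N) f
  obtain ⟨m, y, hy⟩ := exists_generators_of_finite R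
    (finite_linObj_of_mono R (kernel.ι p) (finite_linObj_rep R (hC.hom_finite _ A)))
  obtain ⟨q, hq⟩ := exists_epi_rep_biproduct hK y hy
  have : Epi (ShortComplex.mk _ _ (kernel.condition p)).g := hp
  exact finPres.of_exact hS.exact ⟨_, q, hq⟩ (finPres_rep _)

end

end MainTheorem

end

end KIdempotent

theorem mainTheorem1 {R : Type u} [CommRing R] [IsArtinianRing R]
    {C : Type u} [SmallCategory C] [Preadditive C] [Linear R C]
    (hC : KIdempotent.IsDualizingVariety R C) (A : C) (k : ℕ∞) (hk : 1 ≤ k) :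
    (KIdempotent.CatIdeal.ofTrace (KIdempotent.rep A)).IsKIdempotent (k + 1) ↔
      ∀ X : C, KIdempotent.InPk (KIdempotent.rep A) k
        ((KIdempotent.CatIdeal.ofTrace (KIdempotent.rep A)).module X) := by
  rw [KIdempotent.CatIdeal.isKIdempotent_add_one_iff]
  constructor
  · intro h X
    have hext (N : KIdempotent.CMod C) (hN : Subsingleton (N.obj.obj A)) (n : ℕ)
        (hn : (n : ℕ∞) ≤ k) :
        Subsingleton (Abelian.Ext
          ((KIdempotent.CatIdeal.ofTrace (KIdempotent.rep A)).module X) N n) := by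
      obtain ⟨F, ⟨e⟩⟩ := KIdempotent.exists_pushforward_iso_of_subsingleton A N hN
      have := h X F n hn
      exact KIdempotent.ext_subsingleton_of_iso_right e
    refine KIdempotent.inPk_of_finPres R hC (KIdempotent.finPres_module_ofTrace R hC X
      fun N hN n hn => hext N hN n (le_trans ?_ hk)) hext
    exact_mod_cast hn
  · intro h X F n hn
    exact (h X).ext_subsingleton (KIdempotent.subsingleton_pushforward_obj A F) n hn
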